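/- For a positive integer $k$ let $P(k)$ denote its set of prime factors. For a positive integer $n$ let $$\Delta_n=\{P(k) : 1\le k\le n,\ k \text{ squarefree}\},$$ an abstract simplicial complex (with $\varnothing=P(1)$ as a face). Its vertices are the primes $p\le n$, ordered as $2<3<5<\cdots$. For real $x>0$ and an integer $j\ge 0$ let $\sigma_j^{\mathrm{odd}}(x)$ be the number of odd squarefree integers in $(0,x]$ with exactly $j$ prime factors. Let $\beta_k(\Delta_n)=\operatorname{rank}\widetilde H_k(\Delta_n,\mathbb Z)$ denote the $k$-th Betti number of reduced simplicial homology. A simplicial complex $\Delta$ on a linearly ordered vertex set is called shifted if for every $F\in\Delta$ and all vertices $x<y$ with $x\notin F$ and $y\in F$ one has $(F\setminus\{y\})\cup\{x\}\in\Delta$. **Theorem.** Let $n\ge 1$. The complex $\Delta_n$ is shifted. For every integer $k\ge 0$, $$\beta_k(\Delta_n)=\sigma^{\mathrm{odd}}_{k+1}(n)-\sigma^{\mathrm{odd}}_{k+1}(n/2),$$ which is the number of odd squarefree integers $b$ with $n/2<b\le n$ and exactly $k+1$ prime factors. Moreover, if $n\ge 2$, then the geometric realization of $\Delta_n$ is homotopy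 equivalent to a wedge of finitely many spheres (possibly of different dimensions, including $0$; the empty wedge is a point). -/

import Mathlib

namespace PrimeComplex

section Complexes

variable {V : Type*}

/-- An abstract simplicial complex on vertices from `V`: a family of finite subsets of `V` closed
under taking subsets.  The empty set is allowed as a face (of dimension `-1`). -/
abbrev Complex (V : Type*) := LowerSet (Finset V)

/-- The vertices of a complex. -/
def vertices (K : Complex V) : Set V := {v | {v} ∈ K}

/-- A complex with linearly ordered vertices is shifted if replacing an element of a face by a
smaller vertex outside that face always gives a face again. -/
def IsShifted [LinearOrder V] (K : Complex V) : Prop :=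
  ∀ F ∈ K, ∀ x ∈ vertices K, ∀ y ∈ vertices K, x < y → x ∉ F → y ∈ F →
    insert x (F.erase y) ∈ K

/-- The simplicial boundary map: for `v₀ < ⋯ < vₘ` it sends `{v₀, …, vₘ}` to
`∑ i, (-1) ^ i • ({v₀, …, vₘ} \ {vᵢ})`.  On a single vertex it is the augmentation to the
empty simplex, and the empty simplex is sent to `0`. -/
noncomputable def boundary (V : Type*) [LinearOrder V] : (Finset V →₀ ℤ) →ₗ[ℤ] (Finset V →₀ ℤ) :=
  Finsupp.lift (Finset V →₀ ℤ) ℤ (Finset V) fun F =>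
    ∑ v ∈ F, Finsupp.single (F.erase v) ((-1 : ℤ) ^ (F.filter (· < v)).card)

/-- The group `C_k(K)` of integral simplicial `k`-chains: it is free on the faces with `k + 1`
elements. -/
noncomputable def chains (K : Complex V) (k : ℤ) : Submodule ℤ (Finset V →₀ ℤ) :=
  Finsupp.supported ℤ ℤ {F | F ∈ K ∧ (F.card : ℤ) = k + 1}

/-- The `k`-cycles of the augmented simplicial chain complex. -/
noncomputable def cycles [LinearOrder V] (K : Complex V) (k : ℤ) : Submodule ℤ (Finset V →₀ ℤ) :=
  chains K k ⊓ LinearMap.ker (boundary V)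

/-- The `k`-boundaries of the augmented simplicial chain complex. -/
noncomputable def boundaries [LinearOrder V] (K : Complex V) (k : ℤ) :
    Submodule ℤ (Finset V →₀ ℤ) :=
  (chains K (k + 1)).map (boundary V)

theorem boundary_single [LinearOrder V] (F : Finset V) (c : ℤ) :
    boundary V (Finsupp.single F c) =
      c • ∑ v ∈ F, Finsupp.single (F.erase v) ((-1 : ℤ) ^ (F.filter (· < v)).card) := by
  simp [boundary]

/-- `∂ ∘ ∂ = 0`. -/
theorem boundary_boundary [LinearOrder V] (x : Finset V →₀ ℤ) :
    boundary V (boundary V x) = 0 := by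
  induction x using Finsupp.induction_linear with
  | zero => simp
  | add x y hx hy => simp [hx, hy]
  | single F c =>
    rw [boundary_single, map_smul, map_sum]
    simp only [boundary_single]
    refine (congrArg (c • ·) ?_).trans (smul_zero c)
    simp only [Finset.smul_sum]
    rw [Finset.sum_sigma']
    refine Finset.sum_involution (fun p _ => ⟨p.2, p.1⟩) ?_ ?_ ?_ ?_
    · rintro ⟨v, w⟩ h
      simp only [Finset.mem_sigma, Finset.mem_erase] at h
      obtain ⟨hv, hwv, hw⟩ := h
      have key : ∀ a b : V, a ∈ F → a < b →
          ((F.erase a).filter (· < b)).card + 1 = (F.filter (· < b)).card ∧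
          ((F.erase b).filter (· < a)).card = (F.filter (· < a)).card := by
        intro a b ha hab
        constructor
        · rw [Finset.filter_erase, Finset.card_erase_add_one]
          simp [ha, hab]
        · rw [Finset.filter_erase, Finset.erase_eq_of_notMem]
          simp [hab.le]
      simp only [Finsupp.smul_single, smul_eq_mul, Finset.erase_right_comm (a := w) (b := v)]
      rw [← Finsupp.single_add, ← Finsupp.single_zero]
      congr 1
      rcases lt_or_gt_of_ne hwv with h | h
      · obtain ⟨h1, h2⟩ := key w v hw h
        rw [h2, ← h1]; ring
      · obtain ⟨h1, h2⟩ := key v w hv h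
        rw [h2, ← h1]; ring
    · rintro ⟨v, w⟩ h _ heq
      simp only [Finset.mem_sigma, Finset.mem_erase] at h
      simp only [Sigma.mk.injEq] at heq
      exact h.2.1 heq.1
    · rintro ⟨v, w⟩ h
      simp only [Finset.mem_sigma, Finset.mem_erase] at h ⊢
      exact ⟨h.2.2, h.2.1.symm, h.1⟩
    · rintro ⟨v, w⟩ h
      rfl

/-- Boundaries are cycles, so that the homology below is the usual quotient. -/
theorem boundaries_le_cycles [LinearOrder V] (K : Complex V) (k : ℤ) :
    boundaries K k ≤ cycles K k := by
  rintro _ ⟨x, hx, rfl⟩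
  refine ⟨?_, boundary_boundary x⟩
  revert x
  change chains K (k+1) ≤ (chains K k).comap (boundary V)
  rw [chains, Finsupp.supported_eq_span_single, Submodule.span_le]
  rintro _ ⟨F, ⟨hF, hc⟩, rfl⟩
  simp only [SetLike.mem_coe, Submodule.mem_comap, boundary_single, one_smul]
  refine Submodule.sum_mem _ fun v hv => Finsupp.single_mem_supported _ _ ⟨K.lower (Finset.erase_subset v F) hF, ?_⟩
  rw [← Finset.card_erase_add_one hv] at hc
  push_cast at hc; linarith

/-- Reduced simplicial homology with integer coefficients in degree `k`. -/
abbrev ReducedHomology [LinearOrder V] (K : Complex V) (k : ℤ) : Type _ :=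
  cycles K k ⧸ (boundaries K k).submoduleOf (cycles K k)

/-- The `k`-th reduced Betti number, the rank of `H̃_k(K, ℤ)`. -/
noncomputable def betti [LinearOrder V] (K : Complex V) (k : ℤ) : ℕ :=
  Module.finrank ℤ (ReducedHomology K k)

/-- The geometric realization of a complex with finitely many faces, in barycentric coordinates:
the union over the faces `F` of the simplex spanned by the unit vectors `e_v`, `v ∈ F`.
(For infinite complexes one would need a finer topology.) -/
def realization (K : Complex V) : Set (V → ℝ) :=
  {x | (∀ v, 0 ≤ x v) ∧ ∃ F ∈ K, (∀ v, v ∉ F → x v = 0) ∧ ∑ v ∈ F, x v = 1}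

end Complexes

section Wedges

/-- The identification defining a wedge: all base points are glued to one extra point
(so that the wedge of the empty family is a point). -/
inductive WedgeRel {ι : Type*} (X : ι → Type*) (x₀ : ∀ i, X i) :
    Unit ⊕ (Σ i, X i) → Unit ⊕ (Σ i, X i) → Prop
  | glue (i : ι) : WedgeRel X x₀ (Sum.inl ()) (Sum.inr ⟨i, x₀ i⟩)

/-- The wedge `⋁ᵢ (Xᵢ, x₀ᵢ)` of pointed spaces, with the quotient topology. -/
abbrev Wedge {ι : Type*} (X : ι → Type*) (x₀ : ∀ i, X i) := Quot (WedgeRel X x₀)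

/-- The unit sphere `S^d` in `ℝ^(d+1)`. -/
abbrev Sphere (d : ℕ) := Metric.sphere (0 : EuclideanSpace ℝ (Fin (d + 1))) 1

/-- The base point `(1, 0, …, 0)` of `S^d`. -/
noncomputable def Sphere.base (d : ℕ) : Sphere d :=
  ⟨EuclideanSpace.single 0 1, by simp⟩

/-- A space has the homotopy type of a (finite) wedge of spheres, of possibly different
dimensions; the wedge with no spheres is a point. -/
def IsWedgeOfSpheres (X : Type*) [TopologicalSpace X] : Prop :=
  ∃ (m : ℕ) (d : Fin m → ℕ), Nonempty (ContinuousMap.HomotopyEquiv X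
    (Wedge (fun i => Sphere (d i)) (fun i => Sphere.base (d i))))

end Wedges

/-- The complex `Δ_n`, whose faces are the sets of prime factors of the squarefree positive
integers `k ≤ n`. -/
def Delta (n : ℕ) : Complex ℕ where
  carrier := {F | ∃ k : ℕ, 0 < k ∧ Squarefree k ∧ k ≤ n ∧ F = k.primeFactors}
  lower' := by
    rintro F G hGF ⟨k, hk, hsq, hkn, rfl⟩
    have hdvd : ∏ p ∈ G, p ∣ k := by
      have h := Finset.prod_dvd_prod_of_subset G k.primeFactors (fun p => p) hGF
      rwa [Nat.prod_primeFactors_of_squarefree hsq] at h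
    refine ⟨∏ p ∈ G, p, Nat.pos_of_dvd_of_pos hdvd hk, hsq.squarefree_of_dvd hdvd,
      (Nat.le_of_dvd hk hdvd).trans hkn, ?_⟩
    exact (Nat.primeFactors_prod fun p hp => Nat.prime_of_mem_primeFactors (hGF hp)).symm

/-- `σ_k^odd(x)`: the number of odd squarefree integers in `(0, x]` with `k` prime factors. -/
noncomputable def sigmaOdd (k : ℕ) (x : ℝ) : ℕ :=
  Set.ncard {b : ℕ | 0 < b ∧ (b : ℝ) ≤ x ∧ Odd b ∧ Squarefree b ∧
    ArithmeticFunction.cardFactors b = k}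

end PrimeComplex

/-! Shiftedness holds because replacing a prime by a smaller one lowers the product. The rest
compares `Delta n` with the largest cone with apex 2 inside it. A face outside this cone is the
prime set of an odd squarefree `b` with `n/2 < b ≤ n`, and it is a facet: one more prime would at
least double the product (`eq_of_mem_nonCone_Delta`).

So the complex is a cone with finitely many facets attached along their full boundaries, and
contracting the cone turns each facet into a sphere of the same dimension. Both conclusions are
proved for any complex of this shape.

In homology (`betti_eq_ncard`), coning with the smallest vertex is a chain contraction of the cone,
so a homology class is determined by its coefficients at the facets outside the cone, and these are
arbitrary.

In topology (`IsFacetEnum.isWedgeOfSpheres`), an explicit map collapses the cone to the base point.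
It is a homotopy equivalence because the straight-line contraction of the cone to its apex extends
to a deformation of the whole realization. -/

namespace PrimeComplex

/-! ### Homology of a cone with facets attached. -/

section Homology

variable {V : Type*} [LinearOrder V]

/-- The faces of `K` not lying in the largest subcomplex of `K` that is a cone with apex `v`. -/
def nonCone (K : Complex V) (v : V) : Set (Finset V) :=
  {F | F ∈ K ∧ v ∉ F ∧ insert v F ∉ K}

/-- Coning off chains with apex `v`. -/
noncomputable def coneMap (v : V) : (Finset V →₀ ℤ) →ₗ[ℤ] (Finset V →₀ ℤ) :=
  Finsupp.lift (Finset V →₀ ℤ) ℤ (Finset V) fun F =>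
    if v ∈ F then 0 else Finsupp.single (insert v F) 1

theorem coneMap_single (v : V) (F : Finset V) (c : ℤ) :
    coneMap v (Finsupp.single F c) = if v ∈ F then 0 else Finsupp.single (insert v F) c := by
  simp only [coneMap, Finsupp.lift_apply, zero_smul, Finsupp.sum_single_index]
  split_ifs <;> simp

theorem coneMap_apply_eq_zero {v : V} {G : Finset V} (hG : v ∉ G) (x : Finset V →₀ ℤ) :
    coneMap v x G = 0 := by
  induction x using Finsupp.induction_linear with
  | zero => simp
  | add x y hx hy => simp [hx, hy]
  | single F c =>
    rw [coneMap_single]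
    split_ifs
    · simp
    · rw [Finsupp.single_eq_of_ne]
      rintro rfl
      exact hG (Finset.mem_insert_self _ _)

/-- Since `v` comes first in the order, removing it has sign `+1`, and adding it moves every other
vertex up one place. Hence all other terms of the two summands cancel. -/
theorem boundary_coneMap_single {v : V} {F : Finset V} (hF : ∀ w ∈ F, v ≤ w) (c : ℤ) :
    boundary V (coneMap v (Finsupp.single F c)) + coneMap v (boundary V (Finsupp.single F c)) =
      Finsupp.single F c := by
  rw [coneMap_single, boundary_single, map_smul, map_sum]
  simp only [coneMap_single]
  split_ifs with hv
  · rw [map_zero, zero_add, Finset.sum_eq_single v]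
    · have h0 : F.filter (· < v) = ∅ := Finset.filter_eq_empty_iff.2 fun w hw => (hF w hw).not_gt
      simp [h0, Finset.insert_erase hv]
    · intro w _ hwv
      simp [hv, hwv.symm]
    · exact fun h => absurd hv h
  · rw [boundary_single, Finset.sum_insert hv, Finset.erase_insert hv, ← smul_add, add_assoc,
      ← Finset.sum_add_distrib, Finset.sum_eq_zero, add_zero]
    · have h0 : (insert v F).filter (· < v) = ∅ :=
        Finset.filter_eq_empty_iff.2 fun w hw => by
          rcases Finset.mem_insert.1 hw with rfl | hw
          · exact lt_irrefl _
          · exact (hF w hw).not_gt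
      simp [h0]
    · intro w hw
      have hvw : v ≠ w := fun h => hv (h ▸ hw)
      have hlt : v < w := lt_of_le_of_ne (hF w hw) hvw
      have h1 : ((insert v F).filter (· < w)).card = (F.filter (· < w)).card + 1 := by
        rw [Finset.filter_insert, if_pos hlt, Finset.card_insert_of_notMem]
        simp [hv]
      rw [if_neg (by simp [hv]), Finset.erase_insert_of_ne hvw, h1, ← Finsupp.single_add, pow_succ]
      simp

theorem boundary_coneMap {v : V} {x : Finset V →₀ ℤ}
    (hx : x ∈ Finsupp.supported ℤ ℤ {F : Finset V | ∀ w ∈ F, v ≤ w}) :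
    boundary V (coneMap v x) + coneMap v (boundary V x) = x := by
  rw [Finsupp.supported_eq_span_single] at hx
  induction hx using Submodule.span_induction with
  | mem x h =>
    obtain ⟨F, hF, rfl⟩ := h
    exact boundary_coneMap_single hF 1
  | zero => simp
  | add x y _ _ hx hy =>
    simp only [map_add]
    nth_rewrite 3 [← hx]
    nth_rewrite 3 [← hy]
    abel
  | smul c x _ hx =>
    simp only [map_smul]
    rw [← smul_add, hx]

omit [LinearOrder V] in
theorem map_mem_supported {s t : Set (Finset V)} (f : (Finset V →₀ ℤ) →ₗ[ℤ] (Finset V →₀ ℤ))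
    (h : ∀ F ∈ s, f (Finsupp.single F 1) ∈ Finsupp.supported ℤ ℤ t) {x : Finset V →₀ ℤ}
    (hx : x ∈ Finsupp.supported ℤ ℤ s) : f x ∈ Finsupp.supported ℤ ℤ t := by
  rw [Finsupp.supported_eq_span_single] at hx
  have : Submodule.span ℤ ((fun i => Finsupp.single i (1 : ℤ)) '' s) ≤
      (Finsupp.supported ℤ ℤ t).comap f := by
    rw [Submodule.span_le]
    rintro _ ⟨F, hF, rfl⟩
    exact h F hF
  exact this hx

theorem coneMap_mem_chains {K : Complex V} {v : V} {k : ℤ} {x : Finset V →₀ ℤ}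
    (hx : x ∈ chains K k) (h0 : ∀ F ∈ nonCone K v, x F = 0) : coneMap v x ∈ chains K (k + 1) := by
  have hx' : x ∈ Finsupp.supported ℤ ℤ {F | (F ∈ K ∧ (F.card : ℤ) = k + 1) ∧ F ∉ nonCone K v} := by
    intro F hF
    refine ⟨hx hF, fun hT => ?_⟩
    exact (Finsupp.mem_support_iff.1 hF) (h0 F hT)
  refine map_mem_supported _ ?_ hx'
  rintro F ⟨⟨hFK, hcard⟩, hT⟩
  rw [coneMap_single]
  split_ifs with hv
  · exact Submodule.zero_mem _
  · refine Finsupp.single_mem_supported _ _ ⟨?_, ?_⟩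
    · by_contra h
      exact hT ⟨hFK, hv, h⟩
    · rw [Finset.card_insert_of_notMem hv]
      push_cast
      rw [hcard]

/-- If `v` is the smallest vertex and all faces outside the cone with apex `v` are facets, then
the Betti numbers count these facets. -/
theorem betti_eq_ncard {K : Complex V} {v : V} (hmin : ∀ F ∈ K, ∀ w ∈ F, v ≤ w)
    (hfacet : ∀ F ∈ nonCone K v, ∀ G ∈ K, F ⊆ G → G = F) (k : ℤ)
    (hfin : {F ∈ nonCone K v | (F.card : ℤ) = k + 1}.Finite) :
    betti K k = {F ∈ nonCone K v | (F.card : ℤ) = k + 1}.ncard := by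
  set T : Set (Finset V) := {F ∈ nonCone K v | (F.card : ℤ) = k + 1} with hT
  let ρ : cycles K k →ₗ[ℤ] (T →₀ ℤ) := (Finsupp.lsubtypeDomain T).comp (cycles K k).subtype
  have hρ (z : cycles K k) (F : T) : ρ z F = z.1 F := rfl
  have hbelow {j : ℤ} {x : Finset V →₀ ℤ} (hx : x ∈ chains K j) :
      x ∈ Finsupp.supported ℤ ℤ {F : Finset V | ∀ w ∈ F, v ≤ w} :=
    fun F hF => hmin F (hx hF).1
  -- Faces outside the cone are maximal, hence never a term `G.erase w` of a boundary.
  have hbdry {j : ℤ} {x : Finset V →₀ ℤ} (hx : x ∈ chains K j) {F : Finset V}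
      (hF : F ∈ nonCone K v) : boundary V x F = 0 := by
    have : boundary V x ∈ Finsupp.supported ℤ ℤ {F : Finset V | F ∉ nonCone K v} := by
      refine map_mem_supported _ ?_ hx
      rintro G ⟨hG, -⟩
      rw [boundary_single, one_smul]
      refine Submodule.sum_mem _ fun w hw => Finsupp.single_mem_supported _ _ fun h => ?_
      have := hfacet _ h G hG (Finset.erase_subset _ _)
      rw [this] at hw
      simp at hw
    by_contra h
    exact this (Finsupp.mem_support_iff.2 h) hF
  have hker : LinearMap.ker ρ = (boundaries K k).submoduleOf (cycles K k) := by
    ext ⟨z, hz⟩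
    rw [LinearMap.mem_ker, Submodule.submoduleOf, Submodule.mem_comap, Submodule.subtype_apply]
    constructor
    · intro h
      -- A cycle with zero coefficients on `T` lives in the cone, and there it bounds its own cone.
      refine ⟨coneMap v z, coneMap_mem_chains hz.1 fun F hF => ?_, ?_⟩
      · by_contra hne
        have hc := hz.1 (Finsupp.mem_support_iff.2 hne)
        exact hne (DFunLike.congr_fun h (⟨F, hF, hc.2⟩ : T))
      · have := boundary_coneMap (hbelow hz.1)
        rwa [LinearMap.mem_ker.1 hz.2, map_zero, add_zero] at this
    · rintro ⟨x, hx, hxz⟩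
      ext F
      rw [hρ]
      change z F.1 = 0
      have hxz' : boundary V x = z := hxz
      rw [← hxz']
      exact hbdry hx F.2.1
  have hsurj : Function.Surjective ρ := by
    intro g
    set y : Finset V →₀ ℤ := g.mapDomain Subtype.val with hy
    have hyc : y ∈ chains K k := by
      intro F hF
      obtain ⟨F', -, rfl⟩ := Finset.mem_image.1 (Finsupp.mapDomain_support hF)
      exact ⟨F'.2.1.1, F'.2.2⟩
    have hbc : boundary V y ∈ chains K (k - 1) :=
      (boundaries_le_cycles K (k - 1) ⟨y, by simpa using hyc, rfl⟩).1
    have hcb : coneMap v (boundary V y) ∈ chains K k := by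
      simpa using coneMap_mem_chains hbc fun F hF => hbdry hyc hF
    -- The boundary of `y` lies in the cone, so it can be filled there. The difference equals the
    -- boundary of `coneMap v y`, hence is a cycle, although `coneMap v y` need not be a chain of
    -- `K`. The filling only involves faces containing `v`, so the coefficients on `T` stay those of
    -- `y`.
    refine ⟨⟨y - coneMap v (boundary V y), Submodule.sub_mem _ hyc hcb, ?_⟩, ?_⟩
    · have := boundary_coneMap (hbelow hyc)
      rw [← eq_sub_iff_add_eq] at this
      rw [← this]
      exact boundary_boundary _
    · ext F
      rw [hρ]
      change y F.1 - coneMap v (boundary V y) F.1 = g F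
      rw [coneMap_apply_eq_zero F.2.1.2.1, sub_zero]
      exact Finsupp.mapDomain_apply Subtype.val_injective _ _
  have : Fintype T := hfin.fintype
  have e := (Submodule.quotEquivOfEq _ _ hker.symm).trans (ρ.quotKerEquivOfSurjective hsurj)
  rw [betti, e.finrank_eq, Module.finrank_finsupp_self, ← Nat.card_eq_fintype_card]
  rfl

end Homology


/-! ### An explicit map collapsing the boundary of a simplex to a point of the sphere. -/

section Collapse

variable {d : ℕ}

/-- The smallest coordinate of a vector. -/
noncomputable def minCoord (x : Fin (d + 1) → ℝ) : ℝ :=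
  Finset.univ.inf' Finset.univ_nonempty x

theorem minCoord_le (x : Fin (d + 1) → ℝ) (i : Fin (d + 1)) : minCoord x ≤ x i :=
  Finset.inf'_le _ (Finset.mem_univ i)

theorem exists_eq_minCoord (x : Fin (d + 1) → ℝ) : ∃ i, x i = minCoord x := by
  obtain ⟨i, -, hi⟩ := Finset.exists_mem_eq_inf' Finset.univ_nonempty x
  exact ⟨i, hi.symm⟩

theorem le_minCoord {x : Fin (d + 1) → ℝ} {c : ℝ} (h : ∀ i, c ≤ x i) : c ≤ minCoord x :=
  Finset.le_inf' _ _ fun i _ => h i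

theorem minCoord_eq {x : Fin (d + 1) → ℝ} {c : ℝ} (h : ∀ i, c ≤ x i) (j : Fin (d + 1))
    (hj : x j = c) : minCoord x = c :=
  le_antisymm (hj ▸ minCoord_le x j) (le_minCoord h)

theorem continuous_minCoord : Continuous (minCoord (d := d)) :=
  Continuous.finset_inf'_apply _ fun i _ => continuous_apply i

/-- The squared distance of a vector from the constant vector with the same zeroth coordinate. -/
def spread (x : Fin (d + 1) → ℝ) : ℝ := ∑ i : Fin d, (x i.succ - x 0) ^ 2

theorem spread_nonneg (x : Fin (d + 1) → ℝ) : 0 ≤ spread x :=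
  Finset.sum_nonneg fun _ _ => sq_nonneg _

theorem spread_add_sq_pos {x : Fin (d + 1) → ℝ} (hx : x ∈ stdSimplex ℝ (Fin (d + 1))) :
    0 < spread x + minCoord x ^ 2 := by
  have h0 := spread_nonneg x
  have h1 := sq_nonneg (minCoord x)
  refine lt_of_le_of_ne (add_nonneg h0 h1) fun h => ?_
  have hs : spread x = 0 := by linarith
  have hm : minCoord x = 0 := by
    have : minCoord x ^ 2 = 0 := by linarith
    exact pow_eq_zero_iff two_ne_zero |>.1 this
  have hc : ∀ i, x i = x 0 := by
    intro i
    refine Fin.cases rfl (fun i => ?_) i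
    have := (Finset.sum_eq_zero_iff_of_nonneg fun _ _ => sq_nonneg _).1 hs i (Finset.mem_univ i)
    exact sub_eq_zero.1 (pow_eq_zero_iff two_ne_zero |>.1 this)
  obtain ⟨j, hj⟩ := exists_eq_minCoord x
  have hz : ∀ i, x i = 0 := fun i => by rw [hc i, ← hc j, hj, hm]
  have := hx.2
  simp [hz] at this

/-- The vector underlying `collapse`. -/
noncomputable def collapseVec (x : Fin (d + 1) → ℝ) : EuclideanSpace ℝ (Fin (d + 1)) :=
  -- The vector with entries `(x i.succ - x 0) / minCoord x` identifies the open simplex with `ℝ^d`.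
  -- This is its inverse stereographic projection from the base point, with denominators cleared so
  -- that it extends to `minCoord x = 0`.
  WithLp.toLp 2 (Fin.cons ((spread x - minCoord x ^ 2) / (spread x + minCoord x ^ 2))
    fun i => 2 * minCoord x * (x i.succ - x 0) / (spread x + minCoord x ^ 2))

theorem collapseVec_zero (x : Fin (d + 1) → ℝ) :
    collapseVec x 0 = (spread x - minCoord x ^ 2) / (spread x + minCoord x ^ 2) := rfl

theorem collapseVec_succ (x : Fin (d + 1) → ℝ) (i : Fin d) :
    collapseVec x i.succ = 2 * minCoord x * (x i.succ - x 0) / (spread x + minCoord x ^ 2) := rfl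

theorem norm_collapseVec {x : Fin (d + 1) → ℝ} (hx : 0 < spread x + minCoord x ^ 2) :
    ‖collapseVec x‖ = 1 := by
  have h : ‖collapseVec x‖ ^ 2 = 1 := by
    rw [EuclideanSpace.real_norm_sq_eq, Fin.sum_univ_succ]
    simp only [collapseVec_zero, collapseVec_succ, div_pow, mul_pow]
    rw [← Finset.sum_div, ← Finset.mul_sum, ← add_div, div_eq_one_iff_eq (by positivity)]
    change _ + _ * spread x = _
    ring
  nlinarith [norm_nonneg (collapseVec x)]

/-- The map from the `d`-simplex to the `d`-sphere that collapses the boundary of the simplex to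
the base point and is bijective on the interior. -/
noncomputable def collapse (x : Fin (d + 1) → ℝ) : Sphere d :=
  if h : 0 < spread x + minCoord x ^ 2 then
    ⟨collapseVec x, by simpa using norm_collapseVec h⟩
  else Sphere.base d

theorem coe_collapse {x : Fin (d + 1) → ℝ} (hx : x ∈ stdSimplex ℝ (Fin (d + 1))) :
    (collapse x : EuclideanSpace ℝ (Fin (d + 1))) = collapseVec x := by
  rw [collapse, dif_pos (spread_add_sq_pos hx)]

theorem continuousOn_collapse :
    ContinuousOn (collapse (d := d)) (stdSimplex ℝ (Fin (d + 1))) := by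
  rw [Topology.IsInducing.subtypeVal.continuousOn_iff]
  refine ContinuousOn.congr (f := collapseVec) ?_ fun x hx => coe_collapse hx
  refine (PiLp.continuous_toLp 2 _).comp_continuousOn (continuousOn_pi.2 fun i => ?_)
  have hs : Continuous (spread (d := d)) := by unfold spread; fun_prop
  have hm := continuous_minCoord (d := d)
  refine Fin.cases ?_ (fun i => ?_) i
  · simp only [Fin.cons_zero]
    exact ContinuousOn.div (by fun_prop) (by fun_prop) fun x hx => (spread_add_sq_pos hx).ne'
  · simp only [Fin.cons_succ]
    exact ContinuousOn.div (by fun_prop) (by fun_prop) fun x hx => (spread_add_sq_pos hx).ne'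

theorem collapse_eq_base_iff {x : Fin (d + 1) → ℝ} (hx : x ∈ stdSimplex ℝ (Fin (d + 1))) :
    collapse x = Sphere.base d ↔ minCoord x = 0 := by
  have hp := spread_add_sq_pos hx
  rw [Subtype.ext_iff, coe_collapse hx]
  constructor
  · intro h
    have h0 := congrArg (fun y : EuclideanSpace ℝ (Fin (d + 1)) => y 0) h
    simp only [collapseVec_zero, Sphere.base, PiLp.single_apply, if_true] at h0
    rw [div_eq_one_iff_eq hp.ne'] at h0
    have : minCoord x ^ 2 = 0 := by linarith
    exact pow_eq_zero_iff two_ne_zero |>.1 this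
  · intro h
    ext i
    refine Fin.cases ?_ (fun i => ?_) i
    · rw [collapseVec_zero]
      rw [h] at hp ⊢
      simp only [Sphere.base, PiLp.single_apply, if_true]
      rw [div_eq_one_iff_eq hp.ne']
      ring
    · rw [collapseVec_succ, h]
      simp [Sphere.base]

theorem collapse_injOn :
    Set.InjOn (collapse (d := d)) {x ∈ stdSimplex ℝ (Fin (d + 1)) | 0 < minCoord x} := by
  rintro x ⟨hx, hm⟩ y ⟨hy, hn⟩ h
  have hP := spread_add_sq_pos hx
  have hQ := spread_add_sq_pos hy
  rw [Subtype.ext_iff, coe_collapse hx, coe_collapse hy] at h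
  have h0 := congrArg (fun y : EuclideanSpace ℝ (Fin (d + 1)) => y 0) h
  simp only [collapseVec_zero] at h0
  rw [div_eq_div_iff hP.ne' hQ.ne'] at h0
  have key : ∀ i, (x i - x 0) * minCoord y = (y i - y 0) * minCoord x := by
    intro i
    refine Fin.cases (by simp) (fun i => ?_) i
    have hi := congrArg (fun y : EuclideanSpace ℝ (Fin (d + 1)) => y i.succ) h
    simp only [collapseVec_succ] at hi
    rw [div_eq_div_iff hP.ne' hQ.ne'] at hi
    have h1 : minCoord x ^ 2 * (spread y + minCoord y ^ 2) =
        minCoord y ^ 2 * (spread x + minCoord x ^ 2) := by linarith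
    have h2 : (2 * minCoord y * (spread x + minCoord x ^ 2)) *
        ((x i.succ - x 0) * minCoord y) = (2 * minCoord y *
        (spread x + minCoord x ^ 2)) * ((y i.succ - y 0) * minCoord x) := by
      linear_combination minCoord x * hi - 2 * (x i.succ - x 0) * h1
    exact mul_left_cancel₀ (by positivity) h2
  -- Evaluating `key` where `x` attains its minimum compares the zeroth coordinates. By symmetry
  -- they agree after scaling, so `x` and `y` are proportional, and equal since both have sum 1.
  have le : ∀ {x y : Fin (d + 1) → ℝ}, 0 < minCoord x →
      (∀ i, (x i - x 0) * minCoord y = (y i - y 0) * minCoord x) →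
      x 0 * minCoord y ≤ y 0 * minCoord x := by
    intro x y hm key
    obtain ⟨j, hj⟩ := exists_eq_minCoord x
    have h1 := key j
    have h2 := mul_le_mul_of_nonneg_right (minCoord_le y j) hm.le
    rw [hj] at h1
    nlinarith
  have h00 : x 0 * minCoord y = y 0 * minCoord x :=
    le_antisymm (le hm key) (le hn fun i => (key i).symm)
  have hxy : ∀ i, x i * minCoord y = y i * minCoord x := fun i => by linarith [key i]
  have hmn : minCoord y = minCoord x := by
    have := Finset.sum_congr rfl fun i (_ : i ∈ Finset.univ) => hxy i
    rwa [← Finset.sum_mul, ← Finset.sum_mul, hx.2, hy.2, one_mul, one_mul] at this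
  ext i
  have := hxy i
  rw [hmn] at this
  exact mul_right_cancel₀ hm.ne' this

theorem exists_collapse_eq {y : Sphere d} (hy : y ≠ Sphere.base d) :
    ∃ x ∈ stdSimplex ℝ (Fin (d + 1)), 0 < minCoord x ∧ collapse x = y := by
  obtain ⟨y, hyS⟩ := y
  have hn : ‖y‖ = 1 := by simpa using hyS
  have hsum : y 0 ^ 2 + ∑ i : Fin d, y i.succ ^ 2 = 1 := by
    rw [← Fin.sum_univ_succ (fun i => y i ^ 2), ← EuclideanSpace.real_norm_sq_eq, hn, one_pow]
  have hnn : 0 ≤ ∑ i : Fin d, y i.succ ^ 2 := Finset.sum_nonneg fun _ _ => sq_nonneg _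
  have hlt : y 0 < 1 := by
    refine lt_of_le_of_ne (by nlinarith) fun h1 => hy ?_
    have hz : ∑ i : Fin d, y i.succ ^ 2 = 0 := by rw [h1] at hsum; linarith
    apply Subtype.ext
    ext i
    refine Fin.cases ?_ (fun i => ?_) i
    · simpa [Sphere.base] using h1
    · have := (Finset.sum_eq_zero_iff_of_nonneg fun _ _ => sq_nonneg _).1 hz i (Finset.mem_univ i)
      simpa [Sphere.base] using this
  have hpos : 0 < 1 - y 0 := by linarith
  -- Stereographic projection of `y`. Adding a constant then makes the smallest coordinate 1 without
  -- changing differences, and division by the sum `W` gives a point of the simplex.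
  set z : Fin (d + 1) → ℝ := Fin.cons 0 fun i => y i.succ / (1 - y 0) with hz
  set w : Fin (d + 1) → ℝ := fun i => 1 - minCoord z + z i with hw
  have hw1 : ∀ i, 1 ≤ w i := fun i => by linarith [minCoord_le z i]
  set W := ∑ i, w i with hW
  have hWpos : 0 < W := Finset.sum_pos (fun i _ => by linarith [hw1 i]) Finset.univ_nonempty
  obtain ⟨j, hj⟩ := exists_eq_minCoord z
  have hmin : minCoord (fun i => w i / W) = 1 / W := by
    refine minCoord_eq (fun i => ?_) j ?_
    · exact div_le_div_of_nonneg_right (hw1 i) hWpos.le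
    · simp only [hw, hj]; ring
  have hmem : (fun i => w i / W) ∈ stdSimplex ℝ (Fin (d + 1)) :=
    ⟨fun i => div_nonneg (by linarith [hw1 i]) hWpos.le, by
      rw [← Finset.sum_div]; exact div_self hWpos.ne'⟩
  have hdiff : ∀ i : Fin d, w i.succ / W - w 0 / W = y i.succ / (1 - y 0) / W := by
    intro i
    simp only [hw, hz, Fin.cons_succ, Fin.cons_zero]
    ring
  have hspread : spread (fun i => w i / W) = (1 + y 0) / (1 - y 0) / W ^ 2 := by
    simp only [spread, hdiff, div_pow]
    rw [← Finset.sum_div, ← Finset.sum_div, show ∑ i : Fin d, y i.succ ^ 2 =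
      (1 + y 0) * (1 - y 0) by linarith]
    field_simp
  refine ⟨_, hmem, by rw [hmin]; positivity, ?_⟩
  apply Subtype.ext
  rw [coe_collapse hmem]
  ext i
  refine Fin.cases ?_ (fun i => ?_) i
  · rw [collapseVec_zero, hspread, hmin]
    field_simp
    ring
  · rw [collapseVec_succ, hspread, hmin, hdiff]
    field_simp
    ring

end Collapse


/-! ### Quotient maps that are homotopy equivalences. -/

section Quotients

open unitInterval

/-- A quotient map `p : X → W` is a homotopy equivalence if the identity of `X` can be deformed,
compatibly with the fibres of `p`, to a map that is constant on the fibres of `p`. -/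
theorem nonempty_homotopyEquiv_of_isQuotientMap {X W : Type*} [TopologicalSpace X]
    [TopologicalSpace W] (p : C(X, W)) (hp : Topology.IsQuotientMap p) (H : C(I × X, X))
    (h0 : ∀ x, H (0, x) = x) (h1 : ∀ x y, p x = p y → H (1, x) = H (1, y))
    (ht : ∀ t x y, p x = p y → p (H (t, x)) = p (H (t, y))) :
    Nonempty (ContinuousMap.HomotopyEquiv X W) := by
  set r : W → X := Function.surjInv hp.surjective
  have hr : ∀ w, p (r w) = w := Function.surjInv_eq hp.surjective
  have hq : ∀ x, H (1, r (p x)) = H (1, x) := fun x => h1 _ _ (hr _)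
  have hG : ∀ t x, p (H (t, r (p x))) = p (H (t, x)) := fun t x => ht t _ _ (hr _)
  let q : C(W, X) := ⟨fun w => H (1, r w), hp.continuous_iff.2 <| by
    have : (fun w => H (1, r w)) ∘ p = fun x => H (1, x) := funext hq
    rw [this]
    fun_prop⟩
  -- The section `r` need not be continuous. Continuity is tested on `I × X`, which still carries
  -- the quotient topology down to `I × W` because `I` is locally compact.
  let G : C(I × W, W) := ⟨fun z => p (H (z.1, r z.2)), hp.continuous_lift_prod_right <| by
    have : (fun z : I × X => p (H (z.1, r (p z.2)))) = fun z => p (H z) :=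
      funext fun z => hG z.1 z.2
    simp only [this]
    fun_prop⟩
  refine ⟨⟨p, q, ContinuousMap.Homotopic.symm ⟨⟨H, h0, fun x => (hq x).symm⟩⟩,
    ContinuousMap.Homotopic.symm ⟨⟨G, fun w => ?_, fun w => rfl⟩⟩⟩⟩
  change p (H (0, r w)) = w
  rw [h0, hr]

end Quotients

/-! ### An invariant telling the points of a wedge apart. -/

section WedgePoints

variable {ι : Type*} {X : ι → Type*} {x₀ : ∀ i, X i}

open Classical in
/-- The summand and the point in it of an element of a wedge other than the base point. -/
noncomputable def Wedge.toOption : Wedge X x₀ → Option (Σ i, X i) :=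
  Quot.lift (Sum.elim (fun _ => none) fun y => if y.2 = x₀ y.1 then none else some y) <| by
    rintro _ _ ⟨i⟩
    simp

theorem Wedge.toOption_inl : Wedge.toOption (Quot.mk (WedgeRel X x₀) (Sum.inl ())) = none := rfl

theorem Wedge.toOption_inr {i : ι} {y : X i} (hy : y ≠ x₀ i) :
    Wedge.toOption (Quot.mk (WedgeRel X x₀) (Sum.inr ⟨i, y⟩)) = some ⟨i, y⟩ :=
  if_neg hy

end WedgePoints

/-! ### Barycentric coordinates on a face. -/

section Realization

variable {V : Type*}

/-- Both sums reduce to `F ∩ G`. This is needed because the face witnessing membership in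
`realization K` is not unique. -/
theorem sum_eq_of_support_subset [DecidableEq V] {x : V → ℝ} {F G : Finset V}
    (hF : ∀ w ∉ F, x w = 0) (hG : ∀ w ∉ G, x w = 0) : ∑ w ∈ F, x w = ∑ w ∈ G, x w := by
  rw [← Finset.sum_subset (Finset.inter_subset_left (s₁ := F) (s₂ := G)),
    ← Finset.sum_subset (Finset.inter_subset_right (s₁ := F) (s₂ := G))]
  · intro w _ h2
    by_cases h : w ∈ F
    · exact hG w fun h3 => h2 (Finset.mem_inter.2 ⟨h, h3⟩)
    · exact hF w h
  · intro w _ h2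
    by_cases h : w ∈ F
    · exact hG w fun h3 => h2 (Finset.mem_inter.2 ⟨h, h3⟩)
    · exact hF w h

variable [LinearOrder V]

/-- The coordinates of a vector at the elements of `F`, in increasing order. -/
def faceCoords (F : Finset V) {d : ℕ} (h : F.card = d + 1) (x : V → ℝ) : Fin (d + 1) → ℝ :=
  fun j => x (F.orderEmbOfFin h j)

/-- The smallest coordinate of a vector at an element of `F`. -/
noncomputable def faceMin (F : Finset V) {d : ℕ} (h : F.card = d + 1) (x : V → ℝ) : ℝ :=
  minCoord (faceCoords F h x)

section Face

variable {F : Finset V} {d : ℕ} (h : F.card = d + 1)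

theorem exists_orderEmbOfFin_eq {w : V} (hw : w ∈ F) : ∃ j, F.orderEmbOfFin h j = w := by
  have : w ∈ Set.range (F.orderEmbOfFin h) := by rw [Finset.range_orderEmbOfFin]; exact hw
  exact this

theorem faceMin_le (x : V → ℝ) {w : V} (hw : w ∈ F) : faceMin F h x ≤ x w := by
  obtain ⟨j, rfl⟩ := exists_orderEmbOfFin_eq h hw
  exact minCoord_le _ j

theorem exists_eq_faceMin (x : V → ℝ) : ∃ w ∈ F, x w = faceMin F h x := by
  obtain ⟨j, hj⟩ := exists_eq_minCoord (faceCoords F h x)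
  exact ⟨_, F.orderEmbOfFin_mem h j, hj⟩

theorem faceMin_nonneg {x : V → ℝ} (hx : ∀ w, 0 ≤ x w) : 0 ≤ faceMin F h x :=
  le_minCoord fun _ => hx _

theorem sum_faceCoords (x : V → ℝ) : ∑ j, faceCoords F h x j = ∑ w ∈ F, x w := by
  rw [← Finset.sum_coe_sort F, ← (F.orderIsoOfFin h).toEquiv.sum_comp]
  rfl

theorem continuous_faceCoords : Continuous (faceCoords F h) :=
  continuous_pi fun _ => continuous_apply _

theorem continuous_faceMin : Continuous (faceMin F h) :=
  continuous_minCoord.comp (continuous_faceCoords h)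

/-- The vector with given coordinates at the elements of `F` that vanishes elsewhere. -/
def extendCoords (z : Fin (d + 1) → ℝ) : V → ℝ :=
  fun w => ∑ j, if F.orderEmbOfFin h j = w then z j else 0

theorem faceCoords_extendCoords (z : Fin (d + 1) → ℝ) : faceCoords F h (extendCoords h z) = z := by
  ext j
  simp [faceCoords, extendCoords]

theorem extendCoords_eq_zero (z : Fin (d + 1) → ℝ) {w : V} (hw : w ∉ F) :
    extendCoords h z w = 0 :=
  Finset.sum_eq_zero fun j _ => if_neg fun hj => hw (by rw [← hj]; exact F.orderEmbOfFin_mem h j)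

theorem continuous_extendCoords : Continuous (extendCoords (F := F) h) := by
  unfold extendCoords
  refine continuous_pi fun w => continuous_finsetSum _ fun j _ => ?_
  split_ifs <;> fun_prop

theorem extendCoords_mem_realization {K : Complex V} (hF : F ∈ K) {z : Fin (d + 1) → ℝ}
    (hz : z ∈ stdSimplex ℝ (Fin (d + 1))) : extendCoords h z ∈ realization K := by
  refine ⟨fun w => Finset.sum_nonneg fun j _ => ?_, F, hF, fun w => extendCoords_eq_zero h z, ?_⟩
  · split_ifs
    exacts [hz.1 j, le_rfl]
  · rw [← sum_faceCoords h, faceCoords_extendCoords, hz.2]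

theorem faceCoords_mem_stdSimplex {K : Complex V} {x : V → ℝ} (hx : x ∈ realization K)
    (hF : ∀ w ∉ F, x w = 0) : faceCoords F h x ∈ stdSimplex ℝ (Fin (d + 1)) := by
  obtain ⟨hnn, G, -, hG, hsum⟩ := hx
  refine ⟨fun _ => hnn _, ?_⟩
  rw [sum_faceCoords, sum_eq_of_support_subset hF hG, hsum]

theorem eq_zero_of_faceMin_pos {K : Complex V} (hfacet : ∀ G ∈ K, F ⊆ G → G = F) {x : V → ℝ}
    (hx : x ∈ realization K) (hpos : 0 < faceMin F h x) : ∀ w ∉ F, x w = 0 := by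
  obtain ⟨-, G, hGK, hG, -⟩ := hx
  have : G = F := hfacet G hGK fun w hw => by
    by_contra hwG
    exact (hpos.trans_le (faceMin_le h x hw)).ne' (hG w hwG)
  exact this ▸ hG

end Face

end Realization


/-! ### The deformation extending the contraction of the cone. -/

section Collapsing

open unitInterval

variable {V : Type*} [LinearOrder V]

/-- `F` enumerates the faces of `K` outside the cone with apex the vertex `v`; these are facets,
and the dimension of the `i`-th one is `d i`. -/
structure IsFacetEnum (K : Complex V) (v : V) {m : ℕ} (F : Fin m → Finset V) (d : Fin m → ℕ) :
    Prop where
  apex : {v} ∈ K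
  card : ∀ i, (F i).card = d i + 1
  injective : Function.Injective F
  mem_nonCone : ∀ i, F i ∈ nonCone K v
  exists_eq : ∀ G ∈ nonCone K v, ∃ i, F i = G
  facet : ∀ i, ∀ G ∈ K, F i ⊆ G → G = F i

namespace IsFacetEnum

variable {K : Complex V} {v : V} {m : ℕ} {F : Fin m → Finset V} {d : Fin m → ℕ}
  (D : IsFacetEnum K v F d)

/-- The smallest barycentric coordinate of a point with respect to the `i`-th facet. -/
noncomputable def depth (_ : IsFacetEnum K v F d) (i : Fin m) (x : V → ℝ) : ℝ :=
  if h : (F i).card = d i + 1 then faceMin (F i) h x else 0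

include D

theorem depth_eq (i : Fin m) (x : V → ℝ) : D.depth i x = faceMin (F i) (D.card i) x :=
  dif_pos (D.card i)

theorem continuous_depth (i : Fin m) : Continuous (D.depth i) := by
  simp only [funext (D.depth_eq i)]
  exact continuous_faceMin _

theorem depth_nonneg (i : Fin m) {x : V → ℝ} (hx : x ∈ realization K) : 0 ≤ D.depth i x := by
  rw [depth_eq]
  exact faceMin_nonneg _ hx.1

theorem depth_le (i : Fin m) (x : V → ℝ) {w : V} (hw : w ∈ F i) : D.depth i x ≤ x w := by
  rw [depth_eq]
  exact faceMin_le _ _ hw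

theorem eq_zero_of_depth_pos {i : Fin m} {x : V → ℝ} (hx : x ∈ realization K)
    (hpos : 0 < D.depth i x) : ∀ w ∉ F i, x w = 0 := by
  rw [depth_eq] at hpos
  exact eq_zero_of_faceMin_pos _ (D.facet i) hx hpos

/-- Positive depth makes all coordinates on `F j` nonzero, so `F j ⊆ F i`, and facets are maximal.
-/
theorem eq_of_depth_pos {i j : Fin m} {x : V → ℝ} (hi : ∀ w ∉ F i, x w = 0)
    (hj : 0 < D.depth j x) : j = i := by
  refine D.injective (D.facet j _ (D.mem_nonCone i).1 fun w hw => ?_).symm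
  by_contra hwi
  exact (hj.trans_le (D.depth_le j x hw)).ne' (hi w hwi)

theorem depth_eq_zero_of_ne {i j : Fin m} {x : V → ℝ} (hx : x ∈ realization K)
    (hi : ∀ w ∉ F i, x w = 0) (hij : j ≠ i) : D.depth j x = 0 :=
  ((D.depth_nonneg j hx).eq_or_lt.resolve_right fun h => hij (D.eq_of_depth_pos hi h)).symm

theorem sum_eq_one {i : Fin m} {x : V → ℝ} (hx : x ∈ realization K) (hi : ∀ w ∉ F i, x w = 0) :
    ∑ w ∈ F i, x w = 1 := by
  rw [← sum_faceCoords (D.card i)]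
  exact (faceCoords_mem_stdSimplex (D.card i) hx hi).2

/-- The point of depth zero on the segment from `x` to the apex. -/
theorem segment_mem {x : V → ℝ} (hx : x ∈ realization K) (h0 : ∀ i, D.depth i x = 0) {r : ℝ}
    (hr0 : 0 ≤ r) (hr1 : r ≤ 1) :
    (fun w => (1 - r) * x w + if w = v then r else 0) ∈ realization K ∧
      ∀ i, D.depth i (fun w => (1 - r) * x w + if w = v then r else 0) = 0 := by
  obtain ⟨hnn, G, hGK, hG, hsum⟩ := hx
  have hmem : (fun w => (1 - r) * x w + if w = v then r else 0) ∈ realization K := by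
    -- If the given face is one of the facets, depth zero means that a coordinate vanishes there.
    -- Dropping that vertex leaves a face that is not maximal, hence one in the cone.
    have hcone : ∃ G' ∈ K, (∀ w ∉ G', x w = 0) ∧ G' ∉ nonCone K v := by
      by_cases hT : G ∈ nonCone K v
      · obtain ⟨i, rfl⟩ := D.exists_eq G hT
        obtain ⟨u, hu, hxu⟩ := exists_eq_faceMin (D.card i) x
        rw [← D.depth_eq, h0] at hxu
        have hK := K.lower (Finset.erase_subset u (F i)) hGK
        refine ⟨(F i).erase u, hK, fun w hw => ?_, fun hT' => ?_⟩
        · by_cases hwu : w = u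
          · rw [hwu, hxu]
          · exact hG w fun h => hw (Finset.mem_erase.2 ⟨hwu, h⟩)
        · obtain ⟨j, hj⟩ := D.exists_eq _ hT'
          have h := D.facet j _ hGK (hj ▸ Finset.erase_subset _ _)
          rw [hj] at h
          rw [h] at hu
          simp at hu
      · exact ⟨G, hGK, hG, hT⟩
    obtain ⟨G', hG'K, hG', hT⟩ := hcone
    have hins : insert v G' ∈ K := by
      by_cases hv : v ∈ G'
      · rwa [Finset.insert_eq_of_mem hv]
      · by_contra h
        exact hT ⟨hG'K, hv, h⟩
    have hG'' : ∀ w ∉ insert v G', x w = 0 := fun w hw => hG' w fun h =>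
      hw (Finset.mem_insert_of_mem h)
    refine ⟨fun w => ?_, insert v G', hins, fun w hw => ?_, ?_⟩
    · have := mul_nonneg (sub_nonneg.2 hr1) (hnn w)
      dsimp only
      split_ifs <;> linarith
    · dsimp only
      rw [hG'' w hw, if_neg fun h => hw (by rw [h]; exact Finset.mem_insert_self _ _)]
      ring
    · rw [Finset.sum_add_distrib, ← Finset.mul_sum, sum_eq_of_support_subset hG'' hG, hsum,
        Finset.sum_ite_eq' (insert v G') v, if_pos (Finset.mem_insert_self _ _)]
      ring
  refine ⟨hmem, fun i => le_antisymm ?_ (D.depth_nonneg i hmem)⟩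
  obtain ⟨u, hu, hxu⟩ := exists_eq_faceMin (D.card i) x
  rw [← D.depth_eq, h0] at hxu
  have huv : u ≠ v := fun h => (D.mem_nonCone i).2.1 (h ▸ hu)
  refine (D.depth_le i _ hu).trans ?_
  simp [hxu, huv]

theorem apex_mem : (fun w => if w = v then 1 else 0 : V → ℝ) ∈ realization K :=
  ⟨fun w => by dsimp only; split_ifs <;> norm_num, {v}, D.apex,
    fun w hw => if_neg fun h => hw (by simp [h]), by simp⟩

theorem depth_apex (i : Fin m) : D.depth i (fun w => if w = v then 1 else 0) = 0 := by
  refine le_antisymm ?_ (D.depth_nonneg i D.apex_mem)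
  -- Used only to pick an element of `F i`.
  obtain ⟨u, hu, -⟩ := exists_eq_faceMin (D.card i) (fun _ => 0)
  have huv : u ≠ v := fun h => (D.mem_nonCone i).2.1 (h ▸ hu)
  exact (D.depth_le i _ hu).trans (by simp [huv])

/-- The amount by which the coordinates in the `i`-th facet have decreased at time `t`. -/
noncomputable def loss (i : Fin m) (t : ℝ) (x : V → ℝ) : ℝ :=
  -- The bound `t / 2` keeps the denominator in `push` at least `1/2` for `t ≤ 1`. The other bound
  -- is the loss at which the smallest coordinate reaches 0; the time `t - 2 * loss` left after that
  -- is spent moving to the apex.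
  min (t / 2) ((d i + 1) * D.depth i x)

/-- Points in the interior of a facet are pushed away from its barycentre. -/
noncomputable def push (t : ℝ) (x : V → ℝ) (w : V) : ℝ :=
  (x w - ∑ i, if w ∈ F i then D.loss i t x / (d i + 1) else 0) / (1 - ∑ i, D.loss i t x)

/-- Points in the interior of a facet are pushed towards its boundary, and from there, as all points
of the cone, to the apex. -/
noncomputable def deform (t : ℝ) (x : V → ℝ) (w : V) : ℝ :=
  (1 - (t - 2 * ∑ i, D.loss i t x)) * D.push t x w +
    if w = v then t - 2 * ∑ i, D.loss i t x else 0

theorem loss_eq_zero {i : Fin m} {t : ℝ} {x : V → ℝ} (ht : 0 ≤ t) (h : D.depth i x = 0) :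
    D.loss i t x = 0 := by
  rw [loss, h, mul_zero, min_eq_right (by linarith)]

theorem deform_of_depth_eq_zero {t : ℝ} {x : V → ℝ} (ht : 0 ≤ t) (h : ∀ i, D.depth i x = 0) :
    D.deform t x = fun w => (1 - t) * x w + if w = v then t else 0 := by
  ext w
  simp [deform, push, D.loss_eq_zero ht (h _)]

/-- At most one facet has positive depth at a point. Summing over all facets thus gives a single
formula, visibly continuous, that reduces to one term at each point. -/
theorem sum_loss {i : Fin m} {t : ℝ} {x : V → ℝ} (ht : 0 ≤ t) (hx : x ∈ realization K)
    (hi : ∀ w ∉ F i, x w = 0) : ∑ j, D.loss j t x = D.loss i t x :=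
  Finset.sum_eq_single i (fun _ _ hj => D.loss_eq_zero ht (D.depth_eq_zero_of_ne hx hi hj))
    fun h => absurd (Finset.mem_univ i) h

theorem push_apply {i : Fin m} {t : ℝ} {x : V → ℝ} (ht : 0 ≤ t) (hx : x ∈ realization K)
    (hi : ∀ w ∉ F i, x w = 0) (w : V) : D.push t x w =
      (x w - if w ∈ F i then D.loss i t x / (d i + 1) else 0) / (1 - D.loss i t x) := by
  rw [push, D.sum_loss ht hx hi, Finset.sum_eq_single i]
  · intro j _ hj
    rw [D.loss_eq_zero ht (D.depth_eq_zero_of_ne hx hi hj), zero_div, ite_self]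
  · exact fun h => absurd (Finset.mem_univ i) h

/-- A point has depth zero with respect to all facets or lies on exactly one of them. -/
theorem depth_eq_zero_or {x : V → ℝ} (hx : x ∈ realization K) :
    (∀ i, D.depth i x = 0) ∨ ∃ i, 0 < D.depth i x ∧ ∀ w ∉ F i, x w = 0 := by
  by_cases h : ∃ i, 0 < D.depth i x
  · obtain ⟨i, hi⟩ := h
    exact Or.inr ⟨i, hi, D.eq_zero_of_depth_pos hx hi⟩
  · exact Or.inl fun i => ((D.depth_nonneg i hx).eq_or_lt.resolve_right fun hi => h ⟨i, hi⟩).symm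

theorem sum_loss_le {t : ℝ} {x : V → ℝ} (ht : 0 ≤ t) (hx : x ∈ realization K) :
    ∑ i, D.loss i t x ≤ t / 2 := by
  rcases D.depth_eq_zero_or hx with h | ⟨i, -, hi⟩
  · rw [Finset.sum_eq_zero fun i _ => D.loss_eq_zero ht (h i)]
    linarith
  · rw [D.sum_loss ht hx hi]
    exact min_le_left _ _

theorem deform_zero {x : V → ℝ} (hx : x ∈ realization K) : D.deform 0 x = x := by
  have h : ∀ i, D.loss i 0 x = 0 := fun i => by
    have := D.depth_nonneg i hx
    rw [loss, zero_div, min_eq_left (by positivity)]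
  ext w
  simp [deform, push, h]

theorem push_mem {i : Fin m} {t : ℝ} {x : V → ℝ} (ht0 : 0 ≤ t) (ht1 : t ≤ 1)
    (hx : x ∈ realization K) (hi : ∀ w ∉ F i, x w = 0) :
    D.push t x ∈ realization K ∧ ∀ w ∉ F i, D.push t x w = 0 := by
  have hs : D.loss i t x ≤ t / 2 := min_le_left _ _
  have hs' : D.loss i t x ≤ (d i + 1) * D.depth i x := min_le_right _ _
  have hd : (0 : ℝ) < d i + 1 := by positivity
  have h1 : 0 < 1 - D.loss i t x := by linarith
  have hz : ∀ w ∉ F i, D.push t x w = 0 := fun w hw => by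
    rw [D.push_apply ht0 hx hi, hi w hw, if_neg hw, sub_zero, zero_div]
  refine ⟨⟨fun w => ?_, F i, (D.mem_nonCone i).1, hz, ?_⟩, hz⟩
  · rw [D.push_apply ht0 hx hi]
    refine div_nonneg ?_ h1.le
    split_ifs with hw
    · have := D.depth_le i x hw
      rw [sub_nonneg, div_le_iff₀ hd]
      nlinarith
    · simpa using hx.1 w
  · simp only [D.push_apply ht0 hx hi]
    rw [← Finset.sum_div, Finset.sum_sub_distrib, D.sum_eq_one hx hi,
      Finset.sum_congr rfl fun w hw => if_pos hw, Finset.sum_const, D.card i, nsmul_eq_mul]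
    push_cast
    rw [mul_div_cancel₀ _ hd.ne', div_self h1.ne']

theorem deform_mem {t : ℝ} {x : V → ℝ} (ht0 : 0 ≤ t) (ht1 : t ≤ 1) (hx : x ∈ realization K) :
    D.deform t x ∈ realization K := by
  rcases D.depth_eq_zero_or hx with h | ⟨i, hpos, hi⟩
  · rw [D.deform_of_depth_eq_zero ht0 h]
    exact (D.segment_mem hx h ht0 ht1).1
  · obtain ⟨hp, hpi⟩ := D.push_mem ht0 ht1 hx hi
    have hd : (0 : ℝ) < d i + 1 := by positivity
    unfold deform
    rw [D.sum_loss ht0 hx hi]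
    -- Either the point is still being pushed and no time is left for the segment, or it has reached
    -- the boundary, where `segment_mem` applies.
    rcases le_total (t / 2) ((d i + 1) * D.depth i x) with hle | hle
    · have hs : D.loss i t x = t / 2 := min_eq_left hle
      have hr : t - 2 * D.loss i t x = 0 := by rw [hs]; ring
      simpa [hr] using hp
    · have hs : D.loss i t x = (d i + 1) * D.depth i x := min_eq_right hle
      refine (D.segment_mem hp (fun j => ?_) ?_ ?_).1
      · by_cases hj : j = i
        · subst hj
          obtain ⟨u, hu, hxu⟩ := exists_eq_faceMin (D.card j) x
          refine le_antisymm ((D.depth_le j _ hu).trans ?_) (D.depth_nonneg j hp)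
          rw [D.push_apply ht0 hx hi, if_pos hu, hxu, ← D.depth_eq, hs,
            mul_div_cancel_left₀ _ hd.ne', sub_self, zero_div]
        · exact D.depth_eq_zero_of_ne hp hpi hj
      · linarith
      · nlinarith

theorem continuous_deform : Continuous fun z : I × realization K =>
    D.deform z.1 z.2 := by
  have hd := D.continuous_depth
  have hc : ∀ w, Continuous fun z : I × realization K => (z.2 : V → ℝ) w := fun w =>
    (continuous_apply w).comp (continuous_subtype_val.comp continuous_snd)
  have hl : ∀ i, Continuous fun z : I × realization K => D.loss i z.1 z.2 := by
    intro i
    unfold loss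
    fun_prop
  refine continuous_pi fun w => ?_
  unfold deform push
  refine Continuous.add (Continuous.mul (by fun_prop) (Continuous.div ?_ (by fun_prop) ?_)) ?_
  · refine Continuous.sub (by fun_prop) (continuous_finsetSum _ fun i _ => ?_)
    split_ifs <;> fun_prop
  · intro z
    have := D.sum_loss_le z.1.2.1 z.2.2
    linarith [z.1.2.2]
  · split_ifs <;> fun_prop

end IsFacetEnum

end Collapsing


/-! ### The collapse onto the wedge and its fibres. -/

section Collapsing

open unitInterval

variable {V : Type*} [LinearOrder V]

namespace IsFacetEnum

variable {K : Complex V} {v : V} {m : ℕ} {F : Fin m → Finset V} {d : Fin m → ℕ}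
  (D : IsFacetEnum K v F d)

/-- A wedge of spheres with one sphere for each facet outside the cone. -/
abbrev Spheres (_ : IsFacetEnum K v F d) : Type :=
  Wedge (fun i => Sphere (d i)) (fun i => Sphere.base (d i))

/-- The base point of the wedge of spheres. -/
def basePoint : D.Spheres := Quot.mk _ (Sum.inl ())

/-- The inclusion of a sphere into the wedge. -/
def inclusion (i : Fin m) (y : Sphere (d i)) : D.Spheres := Quot.mk _ (Sum.inr ⟨i, y⟩)

open Classical in
/-- The map to the wedge of spheres that collapses the cone to a point. -/
noncomputable def collapseMap (x : V → ℝ) : D.Spheres :=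
  if h : ∃ i, 0 < D.depth i x then
    D.inclusion h.choose (collapse (faceCoords (F h.choose) (D.card h.choose) x))
  else D.basePoint

theorem inclusion_base (i : Fin m) : D.inclusion i (Sphere.base (d i)) = D.basePoint :=
  (Quot.sound (WedgeRel.glue i)).symm

theorem continuous_inclusion (i : Fin m) : Continuous (D.inclusion i) :=
  continuous_quot_mk.comp (continuous_inr.comp continuous_sigmaMk)

theorem isClosed_iff {s : Set D.Spheres} : IsClosed s ↔ ∀ i, IsClosed (D.inclusion i ⁻¹' s) := by
  refine ⟨fun h i => h.preimage (D.continuous_inclusion i), fun h => ?_⟩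
  rw [← isQuotientMap_quot_mk.isClosed_preimage, isClosed_sum_iff, isClosed_sigma_iff]
  exact ⟨isClosed_discrete _, h⟩

theorem collapseMap_of_depth_eq_zero {x : V → ℝ} (h : ∀ i, D.depth i x = 0) :
    D.collapseMap x = D.basePoint :=
  dif_neg fun ⟨i, hi⟩ => hi.ne' (h i)

/-- On the boundary of the facet both sides are the base point, so the formula holds on the closed
facet, as needed for gluing. -/
theorem collapseMap_of_mem_facet {x : V → ℝ} (hx : x ∈ realization K) {i : Fin m}
    (hi : ∀ w ∉ F i, x w = 0) :
    D.collapseMap x = D.inclusion i (collapse (faceCoords (F i) (D.card i) x)) := by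
  by_cases h : ∃ j, 0 < D.depth j x
  · rw [collapseMap, dif_pos h]
    have heq : ∀ j, j = i → D.inclusion j (collapse (faceCoords (F j) (D.card j) x)) =
        D.inclusion i (collapse (faceCoords (F i) (D.card i) x)) := by
      rintro _ rfl
      rfl
    exact heq _ (D.eq_of_depth_pos hi h.choose_spec)
  · have h0 : D.depth i x = 0 :=
      ((D.depth_nonneg i hx).eq_or_lt.resolve_right fun hi => h ⟨i, hi⟩).symm
    rw [D.depth_eq] at h0
    rw [collapseMap, dif_neg h,
      (collapse_eq_base_iff (faceCoords_mem_stdSimplex (D.card i) hx hi)).2 h0, D.inclusion_base]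

theorem continuous_collapseMap : Continuous fun x : realization K => D.collapseMap x := by
  have hc : ∀ w, Continuous fun x : realization K => (x : V → ℝ) w := fun w =>
    (continuous_apply w).comp continuous_subtype_val
  -- A finite closed cover: `none` is the cone, `some i` the `i`-th closed facet.
  let C : Option (Fin m) → Set (realization K) := fun o =>
    o.elim {x | ∀ i, D.depth i x = 0} fun i => {x | ∀ w ∉ F i, (x : V → ℝ) w = 0}
  refine (locallyFinite_of_finite C).continuous ?_ ?_ ?_
  · refine Set.eq_univ_of_forall fun x => Set.mem_iUnion.2 ?_
    rcases D.depth_eq_zero_or x.2 with h | ⟨i, -, hi⟩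
    exacts [⟨none, h⟩, ⟨some i, hi⟩]
  · rintro (_ | i)
    · have : C none = ⋂ i, {x : realization K | D.depth i x = 0} := by
        ext x
        simp [C]
      rw [this]
      exact isClosed_iInter fun i => isClosed_eq
        ((D.continuous_depth i).comp continuous_subtype_val) continuous_const
    · have : C (some i) = ⋂ w, ⋂ (_ : w ∉ F i), {x : realization K | (x : V → ℝ) w = 0} := by
        ext x
        simp [C]
      rw [this]
      exact isClosed_iInter fun w => isClosed_iInter fun _ => isClosed_eq (hc w) continuous_const
  · rintro (_ | i)
    · exact (continuousOn_const (c := D.basePoint)).congr fun x hx =>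
        D.collapseMap_of_depth_eq_zero hx
    · refine ContinuousOn.congr (f := fun x : realization K =>
        D.inclusion i (collapse (faceCoords (F i) (D.card i) x))) ?_ fun x hx =>
        D.collapseMap_of_mem_facet x.2 hx
      refine (D.continuous_inclusion i).comp_continuousOn (continuousOn_collapse.comp
        ((continuous_faceCoords _).comp continuous_subtype_val).continuousOn fun x hx => ?_)
      exact faceCoords_mem_stdSimplex _ x.2 hx

/-- The parametrization of a facet by the standard simplex. -/
noncomputable def facetMap (i : Fin m) (z : stdSimplex ℝ (Fin (d i + 1))) : realization K :=
  ⟨extendCoords (D.card i) z, extendCoords_mem_realization (D.card i) (D.mem_nonCone i).1 z.2⟩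

theorem continuous_facetMap (i : Fin m) : Continuous (D.facetMap i) :=
  ((continuous_extendCoords _).comp continuous_subtype_val).subtype_mk _

theorem collapseMap_facetMap (i : Fin m) (z : stdSimplex ℝ (Fin (d i + 1))) :
    D.collapseMap (D.facetMap i z) = D.inclusion i (collapse z) := by
  rw [D.collapseMap_of_mem_facet (D.facetMap i z).2 fun w => extendCoords_eq_zero _ _]
  simp only [facetMap, faceCoords_extendCoords]

theorem collapseMap_apex : D.collapseMap (fun w => if w = v then 1 else 0) = D.basePoint :=
  D.collapseMap_of_depth_eq_zero D.depth_apex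

theorem isQuotientMap_collapseMap :
    Topology.IsQuotientMap fun x : realization K => D.collapseMap x := by
  have hcont := D.continuous_collapseMap
  refine Topology.isQuotientMap_iff_isClosed.2 ⟨?_, fun s => ⟨fun h => h.preimage hcont, ?_⟩⟩
  · have hb : ∃ x : realization K, D.collapseMap x = D.basePoint :=
      ⟨⟨_, D.apex_mem⟩, D.collapseMap_apex⟩
    rintro ⟨⟨⟩ | ⟨i, y⟩⟩
    · exact hb
    · by_cases hy : y = Sphere.base (d i)
      · obtain ⟨x, hx⟩ := hb
        refine ⟨x, hx.trans ?_⟩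
        rw [hy]
        exact (D.inclusion_base i).symm
      · obtain ⟨z, hz, -, hzy⟩ := exists_collapse_eq hy
        refine ⟨D.facetMap i ⟨z, hz⟩, (D.collapseMap_facetMap i ⟨z, hz⟩).trans ?_⟩
        exact congrArg (D.inclusion i) hzy
  · intro hs
    refine D.isClosed_iff.2 fun i => ?_
    -- Closedness comes from compactness of each simplex. The base point is treated separately
    -- because `collapse` misses it when `d i = 0`.
    have hset : D.inclusion i ⁻¹' s =
        (fun z : stdSimplex ℝ (Fin (d i + 1)) => collapse (z : Fin (d i + 1) → ℝ)) ''
          (D.facetMap i ⁻¹' ((fun x : realization K => D.collapseMap x) ⁻¹' s)) ∪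
        (D.inclusion i ⁻¹' s ∩ {Sphere.base (d i)}) := by
      ext y
      constructor
      · intro hy
        by_cases hb : y = Sphere.base (d i)
        · exact Or.inr ⟨hy, hb⟩
        · obtain ⟨z, hz, -, rfl⟩ := exists_collapse_eq hb
          refine Or.inl ⟨⟨z, hz⟩, ?_, rfl⟩
          change D.collapseMap (D.facetMap i ⟨z, hz⟩) ∈ s
          rw [D.collapseMap_facetMap]
          exact hy
      · rintro (⟨z, hz, rfl⟩ | hy)
        · change D.collapseMap (D.facetMap i z) ∈ s at hz
          rwa [D.collapseMap_facetMap] at hz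
        · exact hy.1
    rw [hset]
    have hc : Continuous fun z : stdSimplex ℝ (Fin (d i + 1)) =>
        collapse (z : Fin (d i + 1) → ℝ) :=
      continuousOn_iff_continuous_domRestrict.1 continuousOn_collapse
    refine IsClosed.union (IsCompact.isClosed (IsCompact.image ?_ hc))
      ((Set.finite_singleton _).subset Set.inter_subset_right).isClosed
    exact (hs.preimage (D.continuous_facetMap i)).isCompact

/-- `Wedge.toOption` recovers the facet and the point of the sphere; `collapse` is injective on the
interior of the simplex. -/
theorem eq_or_of_collapseMap_eq {x y : V → ℝ} (hx : x ∈ realization K) (hy : y ∈ realization K)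
    (h : D.collapseMap x = D.collapseMap y) :
    x = y ∨ ((∀ i, D.depth i x = 0) ∧ ∀ i, D.depth i y = 0) := by
  have hsome : ∀ {x : V → ℝ} {i : Fin m}, x ∈ realization K → 0 < D.depth i x →
      (∀ w ∉ F i, x w = 0) → Wedge.toOption (D.collapseMap x) =
        some ⟨i, collapse (faceCoords (F i) (D.card i) x)⟩ := by
    intro x i hx hpos hi
    rw [D.collapseMap_of_mem_facet hx hi]
    refine Wedge.toOption_inr fun hb => hpos.ne' ?_
    rw [D.depth_eq]
    exact (collapse_eq_base_iff (faceCoords_mem_stdSimplex _ hx hi)).1 hb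
  have hnone : ∀ {x : V → ℝ}, (∀ i, D.depth i x = 0) →
      Wedge.toOption (D.collapseMap x) = none := by
    intro x h0
    rw [D.collapseMap_of_depth_eq_zero h0]
    exact Wedge.toOption_inl
  have h' := congrArg Wedge.toOption h
  rcases D.depth_eq_zero_or hx with h0 | ⟨i, hpos, hi⟩ <;>
    rcases D.depth_eq_zero_or hy with h0' | ⟨j, hpos', hj⟩
  · exact Or.inr ⟨h0, h0'⟩
  · rw [hnone h0, hsome hy hpos' hj] at h'
    cases h'
  · rw [hnone h0', hsome hx hpos hi] at h'
    cases h'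
  · rw [hsome hx hpos hi, hsome hy hpos' hj, Option.some_inj, Sigma.mk.injEq] at h'
    obtain ⟨rfl, h'⟩ := h'
    rw [D.depth_eq] at hpos hpos'
    have hxy := collapse_injOn ⟨faceCoords_mem_stdSimplex (D.card i) hx hi, hpos⟩
      ⟨faceCoords_mem_stdSimplex (D.card i) hy hj, hpos'⟩ (eq_of_heq h')
    left
    ext w
    by_cases hw : w ∈ F i
    · obtain ⟨k, rfl⟩ := exists_orderEmbOfFin_eq (D.card i) hw
      exact congrFun hxy k
    · rw [hi w hw, hj w hw]

include D in
/-- A complex all of whose faces outside a cone are facets is homotopy equivalent to a wedge of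
spheres. -/
theorem isWedgeOfSpheres : IsWedgeOfSpheres (realization K) := by
  refine ⟨m, d, nonempty_homotopyEquiv_of_isQuotientMap ⟨_, D.continuous_collapseMap⟩
    D.isQuotientMap_collapseMap
    ⟨fun z => ⟨D.deform z.1 z.2, D.deform_mem z.1.2.1 z.1.2.2 z.2.2⟩,
      D.continuous_deform.subtype_mk _⟩ (fun x => Subtype.ext (D.deform_zero x.2)) ?_ ?_⟩
  · intro x y h
    rcases D.eq_or_of_collapseMap_eq x.2 y.2 h with h | ⟨hx, hy⟩
    · rw [Subtype.ext h]
    · refine Subtype.ext ?_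
      change D.deform (1 : ℝ) x = D.deform (1 : ℝ) y
      rw [D.deform_of_depth_eq_zero zero_le_one hx, D.deform_of_depth_eq_zero zero_le_one hy]
      simp
  · intro t x y h
    rcases D.eq_or_of_collapseMap_eq x.2 y.2 h with h | ⟨hx, hy⟩
    · rw [Subtype.ext h]
    · change D.collapseMap (D.deform t x) = D.collapseMap (D.deform t y)
      rw [D.deform_of_depth_eq_zero t.2.1 hx, D.deform_of_depth_eq_zero t.2.1 hy,
        D.collapseMap_of_depth_eq_zero (D.segment_mem x.2 hx t.2.1 t.2.2).2,
        D.collapseMap_of_depth_eq_zero (D.segment_mem y.2 hy t.2.1 t.2.2).2]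

end IsFacetEnum

/-- A complex with finitely many faces outside the cone with apex the vertex `v`, all of them
facets, is homotopy equivalent to a wedge of spheres. -/
theorem isWedgeOfSpheres_realization {K : Complex V} {v : V} (hv : {v} ∈ K)
    (hfin : (nonCone K v).Finite) (hfacet : ∀ F ∈ nonCone K v, ∀ G ∈ K, F ⊆ G → G = F) :
    IsWedgeOfSpheres (realization K) := by
  have := hfin.to_subtype
  obtain ⟨m, ⟨e⟩⟩ := Finite.exists_equiv_fin (nonCone K v)
  refine IsFacetEnum.isWedgeOfSpheres (v := v) (m := m) (F := fun i => e.symm i)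
    (d := fun i => (e.symm i : Finset V).card - 1) ⟨hv, fun i => ?_, ?_, fun i => (e.symm i).2,
      fun G hG => ⟨e ⟨G, hG⟩, by simp⟩, fun i => hfacet _ (e.symm i).2⟩
  -- The truncated subtraction is harmless: the empty face lies in the cone because `{v} ∈ K`.
  · refine (Nat.succ_pred_eq_of_ne_zero fun h => ?_).symm
    have h2 := (e.symm i).2
    rw [Finset.card_eq_zero.1 h] at h2
    exact h2.2.2 (by simpa using hv)
  · exact Subtype.val_injective.comp e.symm.injective

end Collapsing


/-! ### Arithmetic of the complex of squarefree integers. -/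

theorem mem_Delta {n : ℕ} {F : Finset ℕ} :
    F ∈ Delta n ↔ (∀ p ∈ F, p.Prime) ∧ ∏ p ∈ F, p ≤ n := by
  constructor
  · rintro ⟨k, -, hsq, hkn, rfl⟩
    refine ⟨fun p hp => Nat.prime_of_mem_primeFactors hp, ?_⟩
    rwa [Nat.prod_primeFactors_of_squarefree hsq]
  · rintro ⟨hF, hn⟩
    refine ⟨∏ p ∈ F, p, Finset.prod_pos fun p hp => (hF p hp).pos, ?_, hn,
      (Nat.primeFactors_prod hF).symm⟩
    exact Finset.squarefree_prod_of_pairwise_isCoprime (fun p hp q hq hpq =>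
      Nat.coprime_iff_isRelPrime.1 ((Nat.coprime_primes (hF p hp) (hF q hq)).2 hpq))
      fun p hp => (hF p hp).prime.squarefree

theorem vertices_Delta (n : ℕ) : vertices (Delta n) = {p : ℕ | p.Prime ∧ p ≤ n} := by
  ext p
  simp [vertices, mem_Delta]

theorem isShifted_Delta (n : ℕ) : IsShifted (Delta n) := by
  intro F hF x hx y _ hxy hxF hyF
  rw [vertices_Delta] at hx
  rw [mem_Delta] at hF ⊢
  refine ⟨fun p hp => ?_, ?_⟩
  · rcases Finset.mem_insert.1 hp with rfl | hp
    exacts [hx.1, hF.1 p (Finset.mem_of_mem_erase hp)]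
  · rw [Finset.prod_insert fun h => hxF (Finset.mem_of_mem_erase h)]
    refine le_trans (Nat.mul_le_mul_right _ hxy.le) ?_
    rw [Finset.mul_prod_erase F (fun p => p) hyF]
    exact hF.2

theorem mem_nonCone_Delta {n : ℕ} {F : Finset ℕ} : F ∈ nonCone (Delta n) 2 ↔
    ((∀ p ∈ F, p.Prime) ∧ ∏ p ∈ F, p ≤ n) ∧ 2 ∉ F ∧ n < 2 * ∏ p ∈ F, p := by
  rw [nonCone, Set.mem_ofPred_eq, mem_Delta]
  refine and_congr_right fun hF => and_congr_right fun h2 => ?_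
  rw [mem_Delta, Finset.prod_insert h2, not_and, not_le]
  exact ⟨fun h => h fun p hp => by
    rcases Finset.mem_insert.1 hp with rfl | hp
    exacts [Nat.prime_two, hF.1 p hp], fun h _ => h⟩

theorem eq_of_mem_nonCone_Delta {n : ℕ} {F G : Finset ℕ} (hF : F ∈ nonCone (Delta n) 2)
    (hG : G ∈ Delta n) (hFG : F ⊆ G) : G = F := by
  rw [mem_nonCone_Delta] at hF
  rw [mem_Delta] at hG
  by_contra hne
  obtain ⟨p, hpG, hpF⟩ := Finset.exists_of_ssubset (hFG.ssubset_of_ne (Ne.symm hne))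
  have h1 : ∏ q ∈ insert p F, q ≤ ∏ q ∈ G, q :=
    Finset.prod_le_prod_of_subset_of_one_le' (Finset.insert_subset hpG hFG)
      fun q hq _ => (hG.1 q hq).one_lt.le
  rw [Finset.prod_insert hpF] at h1
  have h2 := Nat.mul_le_mul_right (∏ q ∈ F, q) (hG.1 p hpG).two_le
  exact absurd hF.2.2 (not_lt.2 (h2.trans (h1.trans hG.2)))

theorem finite_Delta (n : ℕ) : (Delta n : Set (Finset ℕ)).Finite := by
  refine (Finset.range (n + 1)).powerset.finite_toSet.subset fun F hF => ?_
  have hF' := mem_Delta.1 hF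
  refine Finset.mem_coe.2 (Finset.mem_powerset.2 fun p hp => Finset.mem_range_succ_iff.2 ?_)
  exact (Finset.single_le_prod' (f := fun q => q) (fun q hq => (hF'.1 q hq).one_lt.le) hp).trans
    hF'.2

theorem finite_nonCone_Delta (n : ℕ) : (nonCone (Delta n) 2).Finite :=
  (finite_Delta n).subset fun _ hF => hF.1

theorem card_primeFactors_eq_cardFactors {b : ℕ} (hb : Squarefree b) :
    b.primeFactors.card = ArithmeticFunction.cardFactors b := by
  rw [← (ArithmeticFunction.cardDistinctFactors_eq_cardFactors_iff_squarefree hb.ne_zero).2 hb]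
  rfl

theorem nonCone_Delta_eq_image (n k : ℕ) :
    {F ∈ nonCone (Delta n) 2 | (F.card : ℤ) = (k : ℤ) + 1} =
      Nat.primeFactors '' {b : ℕ | (n : ℝ) / 2 < b ∧ (b : ℝ) ≤ n ∧ Odd b ∧ Squarefree b ∧
        ArithmeticFunction.cardFactors b = k + 1} := by
  ext F
  simp only [Set.mem_ofPred_eq, Set.mem_image, mem_nonCone_Delta]
  constructor
  · rintro ⟨⟨⟨hp, hn⟩, h2, hlt⟩, hcard⟩
    obtain ⟨b, -, hsq, hbn, rfl⟩ := mem_Delta.2 ⟨hp, hn⟩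
    rw [Nat.prod_primeFactors_of_squarefree hsq] at hlt
    refine ⟨b, ⟨?_, by exact_mod_cast hbn, ?_, hsq, ?_⟩, rfl⟩
    · rw [div_lt_iff₀ two_pos, mul_comm]
      exact_mod_cast hlt
    · rw [← Nat.not_even_iff_odd, even_iff_two_dvd]
      exact fun h => h2 (Nat.mem_primeFactors.2 ⟨Nat.prime_two, h, hsq.ne_zero⟩)
    · rw [← card_primeFactors_eq_cardFactors hsq]
      exact_mod_cast hcard
  · rintro ⟨b, ⟨hlt, hbn, hodd, hsq, hcard⟩, rfl⟩
    rw [Nat.prod_primeFactors_of_squarefree hsq]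
    refine ⟨⟨⟨fun p hp => Nat.prime_of_mem_primeFactors hp, by exact_mod_cast hbn⟩,
      fun h => ?_, ?_⟩, ?_⟩
    · exact (Nat.not_even_iff_odd.2 hodd) (even_iff_two_dvd.2 (Nat.dvd_of_mem_primeFactors h))
    · rw [div_lt_iff₀ two_pos, mul_comm] at hlt
      exact_mod_cast hlt
    · rw [card_primeFactors_eq_cardFactors hsq, hcard]
      push_cast
      ring

theorem betti_Delta {n : ℕ} (k : ℕ) : betti (Delta n) k =
    Set.ncard {b : ℕ | (n : ℝ) / 2 < b ∧ (b : ℝ) ≤ n ∧ Odd b ∧ Squarefree b ∧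
      ArithmeticFunction.cardFactors b = k + 1} := by
  -- The apex 2 need not be a vertex here: for `n = 1` the only face outside the cone is `∅`, which
  -- counts in degree `-1` only.
  rw [betti_eq_ncard (v := 2) (fun F hF w hw => ((mem_Delta.1 hF).1 w hw).two_le)
    (fun F hF G hG h => eq_of_mem_nonCone_Delta hF hG h) k
    ((finite_nonCone_Delta n).subset fun _ hF => hF.1), nonCone_Delta_eq_image]
  refine Set.InjOn.ncard_image fun a ha b hb hab => ?_
  rw [← Nat.prod_primeFactors_of_squarefree ha.2.2.2.1, hab,
    Nat.prod_primeFactors_of_squarefree hb.2.2.2.1]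

theorem sigmaOdd_sub (n k : ℕ) :
    (sigmaOdd k (n : ℝ) : ℤ) - (sigmaOdd k ((n : ℝ) / 2) : ℤ) =
      Set.ncard {b : ℕ | (n : ℝ) / 2 < b ∧ (b : ℝ) ≤ n ∧ Odd b ∧ Squarefree b ∧
        ArithmeticFunction.cardFactors b = k} := by
  have hn : (n : ℝ) / 2 ≤ n := half_le_self n.cast_nonneg
  have hfin : ({b : ℕ | 0 < b ∧ (b : ℝ) ≤ (n : ℝ) ∧ Odd b ∧ Squarefree b ∧
      ArithmeticFunction.cardFactors b = k}).Finite :=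
    (Set.finite_Iic n).subset fun b hb => by exact_mod_cast hb.2.1
  have hsub : {b : ℕ | 0 < b ∧ (b : ℝ) ≤ (n : ℝ) / 2 ∧ Odd b ∧ Squarefree b ∧
      ArithmeticFunction.cardFactors b = k} ⊆ {b : ℕ | 0 < b ∧ (b : ℝ) ≤ (n : ℝ) ∧ Odd b ∧
      Squarefree b ∧ ArithmeticFunction.cardFactors b = k} :=
    fun b hb => ⟨hb.1, hb.2.1.trans hn, hb.2.2⟩
  rw [sigmaOdd, sigmaOdd, ← Set.ncard_sdiff_add_ncard_of_subset hsub hfin]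
  push_cast
  rw [add_sub_cancel_right]
  congr 2
  ext b
  simp only [Set.mem_sdiff, Set.mem_ofPred_eq]
  constructor
  · rintro ⟨⟨h0, h1, h2⟩, h3⟩
    exact ⟨not_le.1 fun h => h3 ⟨h0, h, h2⟩, h1, h2⟩
  · rintro ⟨h0, h1, h2⟩
    exact ⟨⟨h2.1.pos, h1, h2⟩, fun h => absurd h.2.1 (not_le.2 h0)⟩

end PrimeComplex

theorem theorem3p1 (n : ℕ) (hn : 1 ≤ n) :
    PrimeComplex.vertices (PrimeComplex.Delta n) = {p : ℕ | p.Prime ∧ p ≤ n} ∧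
    PrimeComplex.IsShifted (PrimeComplex.Delta n) ∧
    (∀ k : ℕ,
      (PrimeComplex.betti (PrimeComplex.Delta n) k : ℤ) =
          (PrimeComplex.sigmaOdd (k + 1) (n : ℝ) : ℤ) -
            (PrimeComplex.sigmaOdd (k + 1) ((n : ℝ) / 2) : ℤ) ∧
      PrimeComplex.betti (PrimeComplex.Delta n) k =
        Set.ncard {b : ℕ | (n : ℝ) / 2 < b ∧ (b : ℝ) ≤ n ∧ Odd b ∧ Squarefree b ∧
          ArithmeticFunction.cardFactors b = k + 1}) ∧
    (2 ≤ n → PrimeComplex.IsWedgeOfSpheres (PrimeComplex.realization (PrimeComplex.Delta n))) := by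

  refine ⟨PrimeComplex.vertices_Delta n, PrimeComplex.isShifted_Delta n, fun k => ⟨?_, ?_⟩,
    fun h2 => ?_⟩
  · rw [PrimeComplex.sigmaOdd_sub, PrimeComplex.betti_Delta]
  · exact PrimeComplex.betti_Delta k
  · exact PrimeComplex.isWedgeOfSpheres_realization (v := 2)
      (PrimeComplex.mem_Delta.2 ⟨by simp [Nat.prime_two], by simpa using h2⟩)
      (PrimeComplex.finite_nonCone_Delta n)
      fun F hF G hG h => PrimeComplex.eq_of_mem_nonCone_Delta hF hG h
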